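/- Let $\mathbb K=\mathbb C\{\!\{t\}\!\}$ be the field of formal Puiseux series $\gamma=\sum_{k\ge m}a_kt^{k/N}$ ($m,N\in\mathbb Z$, $N>0$, $a_k\in\mathbb C$), with $\operatorname{val}(\gamma)$ the lowest exponent of $\gamma$ and $\operatorname{val}(0)=\infty$. A tropical polynomial $F=\bigoplus_{m\in I}c_m\odot x^{\odot m}$ in $d$ variables is a formal linear combination of finitely many monomials with exponents $m\in\mathbb Z^d$ and coefficients $c_m$ in the tropical semiring $(\mathbb R\cup\{\infty\},\oplus=\min,\odot=+)$; $\operatorname{supp}(F)=\{m: c_m\ne\infty\}$, and $F\odot G$ is the product of formal tropical polynomials. If $\operatorname{supp}(F)\neq\emptyset$, then $F$ defines the function $F(x)=\min_{m}(c_m+m\cdot x)$ on $\mathbb R^d$, the tropical hypersurface $T(F)=\{x\in\mathbb R^d : \text{the minimum } F(x) \text{ is attained for at least two } m\in\operatorname{supp}(F)\}$, and the dome $D(F)=\{(p,s)\in\mathbb R^d\times\mathbb R: s\le F(p)\}$ with topological boundary $\partial D(F)$. For a Laurent polynomial $f=\sum_i\gamma_ix^i\in\mathbb K[x_1^{\pm1},\dots,x_d^{\pm1}]$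 put $\operatorname{trop}(f)=\bigoplus_i\operatorname{val}(\gamma_i)\odot x^{\odot i}$ and $V(f)=\{x\in(\mathbb K\setminus\{0\})^d: f(x)=0\}$, and let $\operatorname{val}$ also denote the coordinatewise valuation $(\mathbb K\setminus\{0\})^d\to\mathbb R^d$. **Proposition.** Let $f,g$ be nonzero Laurent polynomials over $\mathbb K$ in $d$ variables, $F=\operatorname{trop}(f)$ and $G=\operatorname{trop}(g)$. Tropicalization commutes with taking unions of hypersurfaces: $$V(f\cdot g)=V(f)\cup V(g)\quad\text{and}\quad T(\operatorname{trop}(f\cdot g))=T(F\odot G)=T(F)\cup T(G).$$ Moreover, in the diagram $$\begin{array}{ccccc} V(f)&\hookrightarrow&V(f\cdot g)&\hookleftarrow&V(g)\\ {\scriptstyle\operatorname{val}}\downarrow&&{\scriptstyle\operatorname{val}}\downarrow&&\downarrow{\scriptstyle\operatorname{val}}\\ T(F)&\hookrightarrow&T(F\odot G)&\hookleftarrow&T(G)\\ \downarrow&&\downarrow&&\downarrow\\ \partial D(F)&\xrightarrow{\ \odot G\ }&\partial D(F\odot G)&\xleftarrow{\ \odot F\ }&\partial D(G) \end{array}$$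 all maps are well defined and all four squares commute. Here the unmarked horizontal arrows are inclusions of subsets, the lower vertical arrows are $w\mapsto(w,F(w))$, $w\mapsto(w,(F\odot G)(w))$ and $w\mapsto(w,G(w))$, the map $\odot G$ sends $(w,s)\in\mathbb R^{d+1}$ to $(w,s+G(w))$, and $\odot F$ sends $(w,s)$ to $(w,s+F(w))$. The map $\odot G$ also sends $D(F)$ into $D(F\odot G)$, and $\odot F$ sends $D(G)$ into $D(F\odot G)$. -/

import Mathlib

namespace TropUnion

noncomputable section

/-- A Hahn series `∑ a_q t^q` (with `q` rational, `a_q` complex) whose exponents have a common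
denominator `N`.  As the support of a Hahn series is well-ordered, these are exactly the series
`∑_{k ≥ m} a_k t^{k/N}` with `m, N` integers and `N > 0`. -/
def IsPuiseux (γ : HahnSeries ℚ ℂ) : Prop :=
  ∃ N : ℕ, 0 < N ∧ ∀ q ∈ γ.support, ∃ k : ℤ, q = (k : ℚ) / (N : ℚ)

/-- The order embedding `k ↦ k / N` of the integers into the rationals. -/
def divEmb (N : ℕ) (hN : 0 < N) : ℤ ↪o ℚ :=
  OrderEmbedding.ofStrictMono (fun k : ℤ => (k : ℚ) / (N : ℚ)) (fun a b hab => by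
    have h : (0 : ℚ) < N := by exact_mod_cast hN
    have h' : (a : ℚ) < b := by exact_mod_cast hab
    exact div_lt_div_of_pos_right h' h)

/-- The substitution `t ↦ t^{1/N}`, a ring homomorphism from Laurent series to Hahn series. -/
def ramify (N : ℕ) (hN : 0 < N) : HahnSeries ℤ ℂ →+* HahnSeries ℚ ℂ :=
  HahnSeries.embDomainRingHom
    { toFun := fun k : ℤ => (k : ℚ) / (N : ℚ), map_zero' := by simp
      map_add' := fun a b => by push_cast; ring }
    (divEmb N hN).injective (fun _ _ => (divEmb N hN).le_iff_le)

theorem mem_range_ramify {N : ℕ} (hN : 0 < N) {γ : HahnSeries ℚ ℂ}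
    (h : ∀ q ∈ γ.support, ∃ k : ℤ, q = (k : ℚ) / (N : ℚ)) : γ ∈ (ramify N hN).range := by
  have hmem : ∀ q : ℚ, q ∉ Set.range (divEmb N hN) → γ.coeff q = 0 := by
    intro q hq
    by_contra hne
    obtain ⟨k, hk⟩ := h q hne
    exact hq ⟨k, hk.symm⟩
  refine ⟨⟨fun k => γ.coeff (divEmb N hN k), ?_⟩, ?_⟩
  · rw [Set.IsPWO, Set.partiallyWellOrderedOn_iff_exists_lt]
    intro u hu
    obtain ⟨m, n, hmn, hle⟩ := Set.partiallyWellOrderedOn_iff_exists_lt.1 γ.isPWO_support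
      (fun i => divEmb N hN (u i)) (fun i => hu i)
    exact ⟨m, n, hmn, (divEmb N hN).le_iff_le.1 hle⟩
  · change HahnSeries.embDomain (divEmb N hN) _ = γ
    ext q
    by_cases hq : q ∈ Set.range (divEmb N hN)
    · obtain ⟨k, rfl⟩ := hq
      rw [HahnSeries.embDomain_coeff]
    · rw [HahnSeries.embDomain_of_notMem_range hq, hmem q hq]

theorem isPuiseux_of_mem_range {N : ℕ} (hN : 0 < N) {γ : HahnSeries ℚ ℂ}
    (h : γ ∈ (ramify N hN).range) : IsPuiseux γ := by
  obtain ⟨δ, rfl⟩ := h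
  refine ⟨N, hN, fun q hq => ?_⟩
  by_contra hne
  refine hq ?_
  change (HahnSeries.embDomain (divEmb N hN) δ).coeff q = 0
  refine HahnSeries.embDomain_of_notMem_range ?_
  rintro ⟨k, hk⟩
  exact hne ⟨k, hk.symm⟩

theorem exists_common_range {γ δ : HahnSeries ℚ ℂ} (hγ : IsPuiseux γ) (hδ : IsPuiseux δ) :
    ∃ (N : ℕ) (hN : 0 < N), γ ∈ (ramify N hN).range ∧ δ ∈ (ramify N hN).range := by
  obtain ⟨M, hM, h1⟩ := hγ
  obtain ⟨N, hN, h2⟩ := hδ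
  have hM' : (M : ℚ) ≠ 0 := by exact_mod_cast hM.ne'
  have hN' : (N : ℚ) ≠ 0 := by exact_mod_cast hN.ne'
  refine ⟨M * N, Nat.mul_pos hM hN, mem_range_ramify _ ?_, mem_range_ramify _ ?_⟩
  · intro q hq
    obtain ⟨k, rfl⟩ := h1 q hq
    exact ⟨k * N, by push_cast; field_simp⟩
  · intro q hq
    obtain ⟨k, rfl⟩ := h2 q hq
    exact ⟨k * M, by push_cast; field_simp⟩

/-- The field of formal Puiseux series with complex coefficients. -/
def puiseux : Subfield (HahnSeries ℚ ℂ) where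
  carrier := {γ | IsPuiseux γ}
  zero_mem' := isPuiseux_of_mem_range Nat.one_pos (zero_mem _)
  one_mem' := isPuiseux_of_mem_range Nat.one_pos (one_mem _)
  add_mem' := fun ha hb => by
    obtain ⟨N, hN, h1, h2⟩ := exists_common_range ha hb
    exact isPuiseux_of_mem_range hN (add_mem h1 h2)
  mul_mem' := fun ha hb => by
    obtain ⟨N, hN, h1, h2⟩ := exists_common_range ha hb
    exact isPuiseux_of_mem_range hN (mul_mem h1 h2)
  neg_mem' := fun ha => by
    obtain ⟨N, hN, h1, _⟩ := exists_common_range ha ha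
    exact isPuiseux_of_mem_range hN (neg_mem h1)
  inv_mem' := fun x hx => by
    obtain ⟨N, hN, ⟨δ, hδ⟩, _⟩ := exists_common_range hx hx
    exact isPuiseux_of_mem_range hN ⟨δ⁻¹, by rw [map_inv₀, hδ]⟩

/-- The field `𝕂 = ℂ{{t}}`. -/
abbrev PuiseuxSeries : Type := ↥puiseux

/-- The valuation (lowest exponent) of a Puiseux series, with `val 0 = ∞`. -/
def val (γ : PuiseuxSeries) : WithTop ℝ :=
  (γ : HahnSeries ℚ ℂ).orderTop.map (fun q : ℚ => (q : ℝ))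

theorem val_zero : val 0 = ⊤ := by simp [val]

/-- The coordinatewise valuation `(𝕂 \ {0})^d → ℝ^d`. -/
def torusVal {d : ℕ} (x : Fin d → PuiseuxSeriesˣ) : Fin d → ℝ :=
  fun i => (((x i : PuiseuxSeries) : HahnSeries ℚ ℂ).order : ℝ)

/-- Laurent polynomials over the Puiseux series in `d` variables: the monoid algebra of `ℤ^d`. -/
abbrev LaurentPoly (d : ℕ) : Type := AddMonoidAlgebra PuiseuxSeries (Fin d → ℤ)

/-- The value of a Laurent polynomial at a point of the algebraic torus. -/
def evalTorus {d : ℕ} (f : LaurentPoly d) (x : Fin d → PuiseuxSeriesˣ) : PuiseuxSeries :=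
  f.coeff.sum fun m γ => γ * ∏ i, ((x i ^ m i : PuiseuxSeriesˣ) : PuiseuxSeries)

/-- The hypersurface `V(f)` in the algebraic torus. -/
def variety {d : ℕ} (f : LaurentPoly d) : Set (Fin d → PuiseuxSeriesˣ) :=
  {x | evalTorus f x = 0}

/-- Formal tropical (Laurent) polynomials in `d` variables, with coefficients in the tropical
semiring `(ℝ ∪ {∞}, min, +)`; the product `F * G` of this semiring is `F ⊙ G`. -/
abbrev TropPoly (d : ℕ) : Type := AddMonoidAlgebra (Tropical (WithTop ℝ)) (Fin d → ℤ)

/-- The tropical monomial `c_m ⊙ x^{⊙ m}`, i.e. `c_m + m · x`. -/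
def tropTerm {d : ℕ} (F : TropPoly d) (m : Fin d → ℤ) (x : Fin d → ℝ) : WithTop ℝ :=
  Tropical.untrop (F.coeff m) + ((∑ i, (m i : ℝ) * x i : ℝ) : WithTop ℝ)

/-- The value `min_{m ∈ supp F} (c_m + m · x)` in `ℝ ∪ {∞}`. -/
def tropValue {d : ℕ} (F : TropPoly d) (x : Fin d → ℝ) : WithTop ℝ :=
  F.coeff.support.inf fun m => tropTerm F m x

/-- The tropical polynomial function `ℝ^d → ℝ` of a tropical polynomial with nonempty support. -/
def tropFun {d : ℕ} (F : TropPoly d) (x : Fin d → ℝ) : ℝ :=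
  (tropValue F x).untopD 0

theorem coe_tropFun {d : ℕ} {F : TropPoly d} (hF : F ≠ 0) (x : Fin d → ℝ) :
    (tropFun F x : WithTop ℝ) = tropValue F x := by
  suffices h : tropValue F x ≠ ⊤ by
    obtain ⟨r, hr⟩ := WithTop.ne_top_iff_exists.1 h
    simp [tropFun, ← hr]
  intro h
  refine hF (AddMonoidAlgebra.coeff_injective (Finsupp.ext fun m => ?_))
  by_contra hm
  have h1 : tropTerm F m x = ⊤ :=
    Finset.inf_eq_top_iff _ _ |>.1 h m (Finsupp.mem_support_iff.2 hm)
  simp only [tropTerm, WithTop.add_eq_top, WithTop.coe_ne_top, or_false] at h1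
  exact hm (Tropical.untrop_injective h1)

/-- The tropical hypersurface `T(F)`: the points where the minimum is attained at least twice. -/
def tropVariety {d : ℕ} (F : TropPoly d) : Set (Fin d → ℝ) :=
  {x | ∃ m ∈ F.coeff.support, ∃ m' ∈ F.coeff.support, m ≠ m' ∧
    tropTerm F m x = tropValue F x ∧ tropTerm F m' x = tropValue F x}

/-- The dome `{(p, s) ∈ ℝ^d × ℝ | s ≤ F(p)}`. -/
def dome {d : ℕ} (F : TropPoly d) : Set ((Fin d → ℝ) × ℝ) :=
  {p | (p.2 : WithTop ℝ) ≤ tropValue F p.1}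

/-- The tropicalization `⨁ val(γ_i) ⊙ x^{⊙ i}` of `∑ γ_i x^i`. -/
def trop {d : ℕ} (f : LaurentPoly d) : TropPoly d :=
  AddMonoidAlgebra.ofCoeff (Finsupp.mapRange (fun γ => Tropical.trop (val γ))
    (by rw [val_zero]; rfl) f.coeff)

/-- The map `⊙ G : (w, s) ↦ (w, s + G(w))`. -/
def odot {d : ℕ} (G : TropPoly d) (p : (Fin d → ℝ) × ℝ) : (Fin d → ℝ) × ℝ :=
  (p.1, p.2 + tropFun G p.1)

/-- The map `w ↦ (w, F(w))` that lifts points to the graph of `F`. -/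
def lift {d : ℕ} (F : TropPoly d) (w : Fin d → ℝ) : (Fin d → ℝ) × ℝ :=
  (w, tropFun F w)

end

end TropUnion

/-! Fix `x` and let `A`, `B` be the sets of exponents where `F` and `G` attain their minimum at `x`.
For `H = F * G` as well as for `H = trop (f * g)`, every term is at least `F(x) + G(x)`, and
equality forces the exponent into `A + B`. Conversely, an element of `A + B` with only one
decomposition gives equality: cancellation of leading coefficients, which could spoil this for `trop
(f * g)`, needs two decompositions. The group `ℤ^d` has unique sums, and two of them once `|A| * |B|
> 1`. Hence the minimum of `H` is `F(x) + G(x)`, attained twice iff `|A| > 1` or `|B| > 1`.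
`minimum_of_sum_bound` isolates this argument.

A zero of `f` has valuation in `T(F)`, since a single least summand cannot cancel. For the domes, `F
⊙ G = F + G` as functions, and the boundary of a dome is the graph. -/

namespace TropUnion

noncomputable section

/-! ### The valuation and sums without cancellation -/

section Valuation

theorem val_eq_top {γ : PuiseuxSeries} : val γ = ⊤ ↔ γ = 0 := by
  simp [val]

theorem val_one : val 1 = 0 := by
  simp [val]

theorem val_mul (γ δ : PuiseuxSeries) : val (γ * δ) = val γ + val δ := by
  simp only [val, Subfield.coe_mul, HahnSeries.orderTop_mul]
  exact WithTop.map_add (Rat.castHom ℝ) _ _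

theorem min_val_le_val_add (γ δ : PuiseuxSeries) : min (val γ) (val δ) ≤ val (γ + δ) := by
  have hmono : Monotone (WithTop.map (fun q : ℚ => (q : ℝ))) :=
    Monotone.withTop_map Rat.cast_mono
  simp only [val, Subfield.coe_add]
  rw [← hmono.map_min]
  exact hmono HahnSeries.min_orderTop_le_orderTop_add

/-- `val` as an additive valuation. -/
def valuation : AddValuation PuiseuxSeries (WithTop ℝ) :=
  AddValuation.of val val_zero val_one min_val_le_val_add val_mul

theorem valuation_apply (γ : PuiseuxSeries) : valuation γ = val γ := rfl

/-- In a finite sum, a summand of strictly least valuation determines the valuation. -/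
theorem val_sum_eq_of_lt {ι : Type*} {s : Finset ι} {u : ι → PuiseuxSeries} {i : ι}
    (hi : i ∈ s) (hne : u i ≠ 0) (hlt : ∀ j ∈ s, j ≠ i → val (u i) < val (u j)) :
    val (∑ j ∈ s, u j) = val (u i) := by
  classical
  rw [← Finset.add_sum_erase s u hi]
  refine valuation.map_add_eq_of_lt_left (valuation.map_lt_sum ?_ fun j hj => ?_)
  · rwa [valuation_apply, Ne, val_eq_top]
  · exact hlt j (Finset.mem_of_mem_erase hj) (Finset.ne_of_mem_erase hj)

/-- The order of a nonzero Puiseux series, as a homomorphism of groups. -/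
def unitsOrder : PuiseuxSeriesˣ →* Multiplicative ℝ where
  toFun u := Multiplicative.ofAdd (((u : PuiseuxSeries) : HahnSeries ℚ ℂ).order : ℝ)
  map_one' := by simp
  map_mul' u v := by
    have hu : ((u : PuiseuxSeries) : HahnSeries ℚ ℂ) ≠ 0 := by simp
    have hv : ((v : PuiseuxSeries) : HahnSeries ℚ ℂ) ≠ 0 := by simp
    simp [HahnSeries.order_mul hu hv, ofAdd_add]

theorem val_unit (u : PuiseuxSeriesˣ) :
    val u = ((unitsOrder u).toAdd : WithTop ℝ) := by
  have hu : ((u : PuiseuxSeries) : HahnSeries ℚ ℂ) ≠ 0 := by simp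
  rw [val, ← HahnSeries.order_eq_orderTop_of_ne_zero hu]
  rfl

theorem val_monomial {d : ℕ} (x : Fin d → PuiseuxSeriesˣ) (m : Fin d → ℤ) :
    val (∏ i, ((x i ^ m i : PuiseuxSeriesˣ) : PuiseuxSeries)) =
      ((∑ i, (m i : ℝ) * torusVal x i : ℝ) : WithTop ℝ) := by
  rw [← Units.coe_prod, val_unit, map_prod, toAdd_prod]
  simp only [map_zpow, toAdd_zpow, zsmul_eq_mul]
  rfl

end Valuation

section Evaluation

variable {d : ℕ}

/-- Evaluation at a point of the torus as a ring homomorphism. -/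
def evalTorusHom (x : Fin d → PuiseuxSeriesˣ) : LaurentPoly d →+* PuiseuxSeries :=
  (AddMonoidAlgebra.lift PuiseuxSeries PuiseuxSeries (Fin d → ℤ)
    { toFun := fun m => ∏ i, ((x i ^ m.toAdd i : PuiseuxSeriesˣ) : PuiseuxSeries)
      map_one' := by simp
      map_mul' := fun m n => by simp [zpow_add, Finset.prod_mul_distrib] }).toRingHom

theorem evalTorusHom_apply (x : Fin d → PuiseuxSeriesˣ) (f : LaurentPoly d) :
    evalTorusHom x f = evalTorus f x := rfl

theorem variety_mul (f g : LaurentPoly d) : variety (f * g) = variety f ∪ variety g := by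
  ext x
  simp [variety, ← evalTorusHom_apply]

end Evaluation

/-! ### Minimizers and the unique-sums argument -/

section TropicalPolynomials

variable {d : ℕ} {F G H : TropPoly d} {x : Fin d → ℝ}

theorem tropValue_le_tropTerm (F : TropPoly d) (m : Fin d → ℤ) (x : Fin d → ℝ) :
    tropValue F x ≤ tropTerm F m x := by
  by_cases hm : m ∈ F.coeff.support
  · exact Finset.inf_le hm
  · have h : tropTerm F m x = ⊤ := by simp [tropTerm, Finsupp.notMem_support_iff.1 hm]
    simp [h]

theorem tropTerm_eq_top {m : Fin d → ℤ} : tropTerm F m x = ⊤ ↔ m ∉ F.coeff.support := by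
  rw [Finsupp.notMem_support_iff, ← Tropical.untrop_inj_iff, tropTerm, WithTop.add_eq_top]
  simp [-WithTop.coe_sum]

theorem tropValue_ne_top (hF : F ≠ 0) (x : Fin d → ℝ) : tropValue F x ≠ ⊤ := by
  rw [← coe_tropFun hF]
  exact WithTop.coe_ne_top

theorem exists_tropTerm_eq_tropValue (hF : F ≠ 0) (x : Fin d → ℝ) :
    ∃ m ∈ F.coeff.support, tropTerm F m x = tropValue F x := by
  have hs : F.coeff.support.Nonempty := by simpa using hF
  obtain ⟨m, hm, h⟩ := Finset.exists_mem_eq_inf F.coeff.support hs fun m => tropTerm F m x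
  exact ⟨m, hm, h.symm⟩

/-- The exponents at which the minimum `F(x)` is attained. -/
def minimizers (F : TropPoly d) (x : Fin d → ℝ) : Finset (Fin d → ℤ) :=
  F.coeff.support.filter fun m => tropTerm F m x = tropValue F x

theorem mem_minimizers (hF : F ≠ 0) {m : Fin d → ℤ} :
    m ∈ minimizers F x ↔ tropTerm F m x = tropValue F x := by
  simp only [minimizers, Finset.mem_filter, and_iff_right_iff_imp]
  intro h
  by_contra hm
  exact tropValue_ne_top hF x (h.symm.trans (tropTerm_eq_top.2 hm))

theorem minimizers_nonempty (hF : F ≠ 0) (x : Fin d → ℝ) : (minimizers F x).Nonempty := by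
  obtain ⟨m, -, h⟩ := exists_tropTerm_eq_tropValue hF x
  exact ⟨m, (mem_minimizers hF).2 h⟩

theorem mem_tropVariety : x ∈ tropVariety F ↔ 1 < (minimizers F x).card := by
  rw [Finset.one_lt_card]
  simp only [tropVariety, Set.mem_ofPred_eq, minimizers, Finset.mem_filter]
  constructor
  · rintro ⟨m, hm, m', hm', hne, h, h'⟩
    exact ⟨m, ⟨hm, h⟩, m', ⟨hm', h'⟩, hne⟩
  · rintro ⟨m, ⟨hm, h⟩, m', ⟨hm', h'⟩, hne⟩
    exact ⟨m, hm, m', hm', hne, h, h'⟩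

/-- If the terms of `H` are bounded below by `F(x) + G(x)`, with equality only at sums of minimizers
and at each sum of minimizers with a unique decomposition, then the minimum of `H` behaves like that
of the product. -/
theorem minimum_of_sum_bound (hF : F ≠ 0) (hG : G ≠ 0)
    (hle : ∀ m, tropValue F x + tropValue G x ≤ tropTerm H m x)
    (hmem : ∀ m, tropTerm H m x = tropValue F x + tropValue G x →
      ∃ a ∈ minimizers F x, ∃ b ∈ minimizers G x, a + b = m)
    (huniq : ∀ a ∈ minimizers F x, ∀ b ∈ minimizers G x,
      UniqueAdd (minimizers F x) (minimizers G x) a b →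
        tropTerm H (a + b) x = tropValue F x + tropValue G x) :
    tropValue H x = tropValue F x + tropValue G x ∧
      (x ∈ tropVariety H ↔ x ∈ tropVariety F ∨ x ∈ tropVariety G) := by
  have hAne := minimizers_nonempty hF x
  have hBne := minimizers_nonempty hG x
  obtain ⟨a, ha, b, hb, hab⟩ := UniqueSums.uniqueAdd_of_nonempty hAne hBne
  have hval : tropValue H x = tropValue F x + tropValue G x :=
    le_antisymm ((tropValue_le_tropTerm H _ x).trans_eq (huniq a ha b hb hab))
      (Finset.le_inf fun m _ => hle m)
  have hH : H ≠ 0 := by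
    rintro rfl
    have h : tropValue F x + tropValue G x = ⊤ := by rw [← hval]; simp [tropValue]
    simp [tropValue_ne_top hF, tropValue_ne_top hG] at h
  refine ⟨hval, ?_⟩
  simp only [mem_tropVariety]
  constructor
  · intro h
    by_contra hcon
    push Not at hcon
    obtain ⟨m, hm, m', hm', hne⟩ := Finset.one_lt_card.1 h
    rw [mem_minimizers hH, hval] at hm hm'
    obtain ⟨a, ha, b, hb, rfl⟩ := hmem m hm
    obtain ⟨a', ha', b', hb', rfl⟩ := hmem m' hm'
    exact hne (by rw [Finset.card_le_one.1 hcon.1 a ha a' ha',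
      Finset.card_le_one.1 hcon.2 b hb b' hb'])
  · intro h
    -- Both factors are positive and one of them exceeds 1.
    have hcard : 1 < (minimizers F x).card * (minimizers G x).card := by
      have h1 := hAne.card_pos
      have h2 := hBne.card_pos
      rcases h with h | h <;> nlinarith
    obtain ⟨p, hp, q, hq, hne, hup, huq⟩ := TwoUniqueSums.uniqueAdd_of_one_lt_card hcard
    rw [Finset.mem_product] at hp hq
    refine Finset.one_lt_card.2 ⟨p.1 + p.2, ?_, q.1 + q.2, ?_, fun h => hne ?_⟩
    · rw [mem_minimizers hH, hval, huniq _ hp.1 _ hp.2 hup]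
    · rw [mem_minimizers hH, hval, huniq _ hq.1 _ hq.2 huq]
    -- Equal sums would be two decompositions of the unique sum `q.1 + q.2`.
    · obtain ⟨h1, h2⟩ := huq hp.1 hp.2 h
      exact Prod.ext h1 h2

end TropicalPolynomials

/-! ### Products of tropical polynomials -/

section Products

variable {d : ℕ} {F G : TropPoly d} {x : Fin d → ℝ}

/-- The coefficients of a product as sums over the decompositions of the exponent. -/
theorem coeff_mul_eq_sum {R M : Type*} [Semiring R] [Add M] [DecidableEq M]
    (f g : AddMonoidAlgebra R M) (m : M) :
    (f * g).coeff m = ∑ p ∈ f.coeff.support ×ˢ g.coeff.support with p.1 + p.2 = m,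
      f.coeff p.1 * g.coeff p.2 := by
  rw [AddMonoidAlgebra.coeff_mul, Finset.sum_filter, Finset.sum_product]
  rfl

theorem untrop_coeff_mul (F G : TropPoly d) (m : Fin d → ℤ) :
    Tropical.untrop ((F * G).coeff m) =
      (Finset.filter (fun p => p.1 + p.2 = m) (F.coeff.support ×ˢ G.coeff.support)).inf
        fun p => Tropical.untrop (F.coeff p.1) + Tropical.untrop (G.coeff p.2) := by
  rw [coeff_mul_eq_sum, Finset.untrop_sum']
  rfl

theorem tropTerm_add_tropTerm (F G : TropPoly d) (a b : Fin d → ℤ) (x : Fin d → ℝ) :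
    tropTerm F a x + tropTerm G b x =
      Tropical.untrop (F.coeff a) + Tropical.untrop (G.coeff b) +
        ((∑ i, ((a + b) i : ℝ) * x i : ℝ) : WithTop ℝ) := by
  simp only [tropTerm, Pi.add_apply, Int.cast_add, add_mul, Finset.sum_add_distrib, WithTop.coe_add]
  abel

theorem tropTerm_mul_le (F G : TropPoly d) (a b : Fin d → ℤ) (x : Fin d → ℝ) :
    tropTerm (F * G) (a + b) x ≤ tropTerm F a x + tropTerm G b x := by
  by_cases ha : a ∈ F.coeff.support
  · by_cases hb : b ∈ G.coeff.support
    · rw [tropTerm_add_tropTerm, tropTerm, untrop_coeff_mul]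
      gcongr
      exact Finset.inf_le (f := fun p : (Fin d → ℤ) × (Fin d → ℤ) =>
        Tropical.untrop (F.coeff p.1) + Tropical.untrop (G.coeff p.2)) (b := (a, b))
        (by simp [ha, hb, -Finsupp.mem_support_iff])
    · simp [tropTerm_eq_top.2 hb]
  · simp [tropTerm_eq_top.2 ha]

theorem exists_tropTerm_mul_eq {m : Fin d → ℤ} (hm : m ∈ (F * G).coeff.support) :
    ∃ a b, a + b = m ∧ tropTerm (F * G) m x = tropTerm F a x + tropTerm G b x := by
  have hne : Tropical.untrop ((F * G).coeff m) ≠ ⊤ := fun h =>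
    Finsupp.mem_support_iff.1 hm (Tropical.untrop_injective h)
  rw [untrop_coeff_mul] at hne
  obtain ⟨p, hp, h⟩ := Finset.exists_mem_eq_inf
    (Finset.filter (fun p => p.1 + p.2 = m) (F.coeff.support ×ˢ G.coeff.support))
    (Finset.nonempty_iff_ne_empty.2 fun h => hne (by rw [h, Finset.inf_empty]))
    fun p : (Fin d → ℤ) × (Fin d → ℤ) =>
      Tropical.untrop (F.coeff p.1) + Tropical.untrop (G.coeff p.2)
  obtain rfl := (Finset.mem_filter.1 hp).2
  exact ⟨p.1, p.2, rfl, by rw [tropTerm_add_tropTerm, tropTerm, untrop_coeff_mul, h]⟩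

theorem add_tropValue_le_tropTerm_mul (F G : TropPoly d) (m : Fin d → ℤ) (x : Fin d → ℝ) :
    tropValue F x + tropValue G x ≤ tropTerm (F * G) m x := by
  by_cases hm : m ∈ (F * G).coeff.support
  · obtain ⟨a, b, -, h⟩ := exists_tropTerm_mul_eq (x := x) hm
    rw [h]
    exact add_le_add (tropValue_le_tropTerm F a x) (tropValue_le_tropTerm G b x)
  · simp [tropTerm_eq_top.2 hm]

/-- A sum of two terms is minimal only if both terms are. -/
theorem mem_minimizers_of_add_le (hF : F ≠ 0) (hG : G ≠ 0) {a b : Fin d → ℤ}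
    (h : tropTerm F a x + tropTerm G b x ≤ tropValue F x + tropValue G x) :
    a ∈ minimizers F x ∧ b ∈ minimizers G x := by
  have h1 := tropValue_le_tropTerm F a x
  have h2 := tropValue_le_tropTerm G b x
  rw [mem_minimizers hF, mem_minimizers hG]
  constructor
  · refine le_antisymm ?_ h1
    by_contra! hlt
    exact absurd h (not_le.2 (WithTop.add_lt_add_of_lt_of_le (tropValue_ne_top hG x) hlt h2))
  · refine le_antisymm ?_ h2
    by_contra! hlt
    exact absurd h (not_le.2 (WithTop.add_lt_add_of_le_of_lt (tropValue_ne_top hF x) h1 hlt))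

/-- The hypothesis is an inequality so that it also serves `trop (f * g)`, whose terms dominate
those of `trop f * trop g`. -/
theorem exists_minimizers_of_tropTerm_mul_le (hF : F ≠ 0) (hG : G ≠ 0) {m : Fin d → ℤ}
    (h : tropTerm (F * G) m x ≤ tropValue F x + tropValue G x) :
    ∃ a ∈ minimizers F x, ∃ b ∈ minimizers G x, a + b = m := by
  have hm : m ∈ (F * G).coeff.support := by
    by_contra hm
    rw [tropTerm_eq_top.2 hm, top_le_iff, WithTop.add_eq_top] at h
    exact h.elim (tropValue_ne_top hF x) (tropValue_ne_top hG x)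
  obtain ⟨a, b, hab, hab'⟩ := exists_tropTerm_mul_eq (x := x) hm
  obtain ⟨ha, hb⟩ := mem_minimizers_of_add_le hF hG (hab' ▸ h)
  exact ⟨a, ha, b, hb, hab⟩

theorem minimum_mul (hF : F ≠ 0) (hG : G ≠ 0) (x : Fin d → ℝ) :
    tropValue (F * G) x = tropValue F x + tropValue G x ∧
      (x ∈ tropVariety (F * G) ↔ x ∈ tropVariety F ∨ x ∈ tropVariety G) := by
  refine minimum_of_sum_bound hF hG (fun m => add_tropValue_le_tropTerm_mul F G m x)
    (fun m hm => exists_minimizers_of_tropTerm_mul_le hF hG hm.le) fun a ha b hb _ => ?_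
  -- Tropical addition never cancels, so every sum of minimizers attains the bound.
  refine le_antisymm ?_ (add_tropValue_le_tropTerm_mul F G _ x)
  rw [← (mem_minimizers hF).1 ha, ← (mem_minimizers hG).1 hb]
  exact tropTerm_mul_le F G a b x

theorem tropVariety_mul (hF : F ≠ 0) (hG : G ≠ 0) :
    tropVariety (F * G) = tropVariety F ∪ tropVariety G :=
  Set.ext fun x => (minimum_mul hF hG x).2

theorem mul_ne_zero_of_tropValue (hF : F ≠ 0) (hG : G ≠ 0) : F * G ≠ 0 := by
  intro h0
  have h := (minimum_mul hF hG 0).1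
  rw [h0] at h
  have htop : tropValue F 0 + tropValue G 0 = ⊤ := by rw [← h]; simp [tropValue]
  simp [tropValue_ne_top hF, tropValue_ne_top hG] at htop

theorem tropFun_mul (hF : F ≠ 0) (hG : G ≠ 0) (x : Fin d → ℝ) :
    tropFun (F * G) x = tropFun F x + tropFun G x := by
  have h := (minimum_mul hF hG x).1
  rw [← coe_tropFun hF, ← coe_tropFun hG, ← coe_tropFun (mul_ne_zero_of_tropValue hF hG)] at h
  exact_mod_cast h

end Products

/-! ### Tropicalization of products and of zeros -/

section Tropicalization

variable {d : ℕ} {f g : LaurentPoly d} {x : Fin d → ℝ}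

theorem untrop_coeff_trop (f : LaurentPoly d) (m : Fin d → ℤ) :
    Tropical.untrop ((trop f).coeff m) = val (f.coeff m) := rfl

theorem support_trop (f : LaurentPoly d) : (trop f).coeff.support = f.coeff.support := by
  ext m
  rw [Finsupp.mem_support_iff, Finsupp.mem_support_iff, Ne, Ne, ← Tropical.untrop_inj_iff,
    untrop_coeff_trop, Tropical.untrop_zero, val_eq_top]

theorem trop_ne_zero (hf : f ≠ 0) : trop f ≠ 0 := by
  rwa [Ne, ← AddMonoidAlgebra.coeff_eq_zero, ← Finsupp.support_eq_empty, support_trop,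
    Finsupp.support_eq_empty, AddMonoidAlgebra.coeff_eq_zero]

/-- Cancellation among the summands of a coefficient of `f * g` can only raise its valuation. -/
theorem tropTerm_mul_le_tropTerm_trop (f g : LaurentPoly d) (m : Fin d → ℤ) (x : Fin d → ℝ) :
    tropTerm (trop f * trop g) m x ≤ tropTerm (trop (f * g)) m x := by
  rw [tropTerm, tropTerm, untrop_coeff_mul, untrop_coeff_trop, coeff_mul_eq_sum, support_trop,
    support_trop]
  gcongr
  refine valuation.map_le_sum fun p hp => (Finset.inf_le hp).trans_eq ?_
  rw [valuation_apply, val_mul]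
  rfl

/-- Among the products contributing to the coefficient at `a + b`, the one from `(a, b)` has
strictly least valuation, so it survives. -/
theorem tropTerm_trop_mul_of_uniqueAdd (hf : f ≠ 0) (hg : g ≠ 0) {a b : Fin d → ℤ}
    (ha : a ∈ minimizers (trop f) x) (hb : b ∈ minimizers (trop g) x)
    (hab : UniqueAdd (minimizers (trop f) x) (minimizers (trop g) x) a b) :
    tropTerm (trop (f * g)) (a + b) x = tropValue (trop f) x + tropValue (trop g) x := by
  have hF := trop_ne_zero hf
  have hG := trop_ne_zero hg
  have ha' : a ∈ f.coeff.support := support_trop f ▸ (Finset.mem_filter.1 ha).1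
  have hb' : b ∈ g.coeff.support := support_trop g ▸ (Finset.mem_filter.1 hb).1
  have key : val ((f * g).coeff (a + b)) = val (f.coeff a * g.coeff b) := by
    rw [coeff_mul_eq_sum]
    refine val_sum_eq_of_lt (u := fun p : (Fin d → ℤ) × (Fin d → ℤ) =>
      f.coeff p.1 * g.coeff p.2) (i := (a, b)) (by simp_all)
      (mul_ne_zero (Finsupp.mem_support_iff.1 ha') (Finsupp.mem_support_iff.1 hb')) ?_
    intro p hp hne
    have hsum : p.1 + p.2 = a + b := (Finset.mem_filter.1 hp).2
    by_contra! hle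
    -- Decompositions of `a + b` share the same linear part, so comparing valuations amounts to
    -- comparing terms.
    have h : tropTerm (trop f) p.1 x + tropTerm (trop g) p.2 x ≤
        tropTerm (trop f) a x + tropTerm (trop g) b x := by
      rw [tropTerm_add_tropTerm, tropTerm_add_tropTerm, hsum]
      simp only [untrop_coeff_trop, ← val_mul]
      gcongr
    rw [(mem_minimizers hF).1 ha, (mem_minimizers hG).1 hb] at h
    obtain ⟨h1, h2⟩ := mem_minimizers_of_add_le hF hG h
    obtain ⟨h3, h4⟩ := hab h1 h2 hsum
    exact hne (Prod.ext h3 h4)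
  rw [← (mem_minimizers hF).1 ha, ← (mem_minimizers hG).1 hb, tropTerm_add_tropTerm, tropTerm]
  simp only [untrop_coeff_trop, key, val_mul]

theorem tropVariety_trop_mul (hf : f ≠ 0) (hg : g ≠ 0) :
    tropVariety (trop (f * g)) = tropVariety (trop f) ∪ tropVariety (trop g) :=
  Set.ext fun x => (minimum_of_sum_bound (trop_ne_zero hf) (trop_ne_zero hg)
    (fun m => (add_tropValue_le_tropTerm_mul _ _ m x).trans
      (tropTerm_mul_le_tropTerm_trop f g m x))
    (fun m hm => exists_minimizers_of_tropTerm_mul_le (trop_ne_zero hf) (trop_ne_zero hg)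
      ((tropTerm_mul_le_tropTerm_trop f g m x).trans hm.le))
    fun _ ha _ hb hab => tropTerm_trop_mul_of_uniqueAdd hf hg ha hb hab).2

/-- The valuation of a zero of `f` lies on the tropical hypersurface of `f`. -/
theorem torusVal_mem_tropVariety (hf : f ≠ 0) {y : Fin d → PuiseuxSeriesˣ} (hy : y ∈ variety f) :
    torusVal y ∈ tropVariety (trop f) := by
  have hF := trop_ne_zero hf
  have hterm (m : Fin d → ℤ) :
      val (f.coeff m * ∏ i, ((y i ^ m i : PuiseuxSeriesˣ) : PuiseuxSeries)) =
        tropTerm (trop f) m (torusVal y) := by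
    rw [val_mul, val_monomial, tropTerm, untrop_coeff_trop]
  obtain ⟨a, ha, hmin⟩ := exists_tropTerm_eq_tropValue hF (torusVal y)
  by_contra hcon
  have hsum : val (evalTorus f y) = tropTerm (trop f) a (torusVal y) := by
    rw [← hterm]
    refine val_sum_eq_of_lt (u := fun m =>
      f.coeff m * ∏ i, ((y i ^ m i : PuiseuxSeriesˣ) : PuiseuxSeries)) (support_trop f ▸ ha) ?_ ?_
    · rw [Ne, ← val_eq_top, hterm, hmin]
      exact tropValue_ne_top hF _
    · intro m hm hne
      rw [hterm, hterm, hmin]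
      -- Equality would make `m` a second minimizer.
      refine lt_of_le_of_ne (tropValue_le_tropTerm _ m _) fun h => hcon ?_
      exact ⟨a, ha, m, (support_trop f).symm ▸ hm, hne.symm, hmin, h.symm⟩
  rw [show evalTorus f y = 0 from hy, val_zero, hmin] at hsum
  exact tropValue_ne_top hF _ hsum.symm

end Tropicalization

/-! ### Domes and their boundaries -/

section Domes

variable {d : ℕ} {F G : TropPoly d}

theorem mem_dome (hF : F ≠ 0) {p : (Fin d → ℝ) × ℝ} : p ∈ dome F ↔ p.2 ≤ tropFun F p.1 := by
  rw [dome, Set.mem_ofPred_eq, ← coe_tropFun hF, WithTop.coe_le_coe]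

theorem continuous_tropFun (hF : F ≠ 0) : Continuous (tropFun F) := by
  have hs : F.coeff.support.Nonempty := by simpa using hF
  -- Coefficients on the support are finite, so the default 0 never enters.
  have heq : tropFun F = fun x => F.coeff.support.inf' hs fun m =>
      (Tropical.untrop (F.coeff m)).untopD 0 + ∑ i, (m i : ℝ) * x i := by
    funext x
    rw [← WithTop.coe_inj, coe_tropFun hF, Finset.coe_inf', tropValue]
    refine Finset.inf_congr rfl fun m hm => ?_
    have hne : Tropical.untrop (F.coeff m) ≠ ⊤ := fun h =>
      Finsupp.mem_support_iff.1 hm (Tropical.untrop_injective h)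
    obtain ⟨c, hc⟩ := WithTop.ne_top_iff_exists.1 hne
    simp [tropTerm, ← hc]
  rw [heq]
  exact Continuous.finset_inf'_apply hs fun m _ => by fun_prop

/-- By continuity the frontier lies in the graph; conversely, points just above the graph leave the
dome. -/
theorem frontier_dome (hF : F ≠ 0) :
    frontier (dome F) = {p : (Fin d → ℝ) × ℝ | p.2 = tropFun F p.1} := by
  have hdome : dome F = {p : (Fin d → ℝ) × ℝ | p.2 ≤ tropFun F p.1} :=
    Set.ext fun _ => mem_dome hF
  have hcont : Continuous fun p : (Fin d → ℝ) × ℝ => tropFun F p.1 :=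
    (continuous_tropFun hF).comp continuous_fst
  rw [hdome]
  refine Set.Subset.antisymm (frontier_le_subset_eq continuous_snd hcont) ?_
  rintro ⟨w, s⟩ (hs : s = tropFun F w)
  subst hs
  refine ⟨subset_closure (by simp), fun hint => ?_⟩
  have hnhds : ∀ᶠ t in nhds (tropFun F w), t ≤ tropFun F w :=
    (Continuous.prodMk_right w).continuousAt.eventually (mem_interior_iff_mem_nhds.1 hint)
  obtain ⟨t, hlt, hle⟩ := ((frequently_gt_nhds (tropFun F w)).and_eventually hnhds).exists
  exact absurd hle (not_le.2 hlt)

theorem mapsTo_lift (hF : F ≠ 0) (s : Set (Fin d → ℝ)) :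
    Set.MapsTo (lift F) s (frontier (dome F)) := by
  intro w _
  rw [frontier_dome hF]
  rfl

theorem mapsTo_odot_dome (hF : F ≠ 0) (hG : G ≠ 0) :
    Set.MapsTo (odot G) (dome F) (dome (F * G)) := by
  intro p hp
  rw [mem_dome hF] at hp
  rw [mem_dome (mul_ne_zero_of_tropValue hF hG)]
  simpa [odot, tropFun_mul hF hG] using hp

theorem mapsTo_odot_frontier (hF : F ≠ 0) (hG : G ≠ 0) :
    Set.MapsTo (odot G) (frontier (dome F)) (frontier (dome (F * G))) := by
  intro p hp
  rw [frontier_dome hF, Set.mem_ofPred_eq] at hp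
  rw [frontier_dome (mul_ne_zero_of_tropValue hF hG), Set.mem_ofPred_eq]
  simpa [odot, tropFun_mul hF hG] using hp

theorem odot_lift (hF : F ≠ 0) (hG : G ≠ 0) (w : Fin d → ℝ) :
    odot G (lift F w) = lift (F * G) w := by
  simp [odot, lift, tropFun_mul hF hG]

end Domes

end

end TropUnion

open TropUnion in
theorem mainTheorem5 (d : ℕ) (f g : LaurentPoly d) (hf : f ≠ 0) (hg : g ≠ 0)
    (F G : TropPoly d) (hF : F = trop f) (hG : G = trop g) :
    -- forming hypersurfaces turns products into unions, classically and tropically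
    variety (f * g) = variety f ∪ variety g ∧
    tropVariety (F * G) = tropVariety F ∪ tropVariety G ∧
    tropVariety (trop (f * g)) = tropVariety (F * G) ∧
    -- on the domes themselves
    Set.MapsTo (odot G) (dome F) (dome (F * G)) ∧
    Set.MapsTo (odot F) (dome G) (dome (F * G)) ∧
    -- the arrows of the diagram are well defined
    ∃ (i₁ : variety f ⊆ variety (f * g)) (i₂ : variety g ⊆ variety (f * g))
      (v₁ : Set.MapsTo torusVal (variety f) (tropVariety F))
      (v : Set.MapsTo torusVal (variety (f * g)) (tropVariety (F * G)))
      (v₂ : Set.MapsTo torusVal (variety g) (tropVariety G))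
      (j₁ : tropVariety F ⊆ tropVariety (F * G)) (j₂ : tropVariety G ⊆ tropVariety (F * G))
      (l₁ : Set.MapsTo (lift F) (tropVariety F) (frontier (dome F)))
      (l : Set.MapsTo (lift (F * G)) (tropVariety (F * G)) (frontier (dome (F * G))))
      (l₂ : Set.MapsTo (lift G) (tropVariety G) (frontier (dome G)))
      (o₁ : Set.MapsTo (odot G) (frontier (dome F)) (frontier (dome (F * G))))
      (o₂ : Set.MapsTo (odot F) (frontier (dome G)) (frontier (dome (F * G)))),
      -- the upper left and upper right squares commute
      v.restrict ∘ Set.inclusion i₁ = Set.inclusion j₁ ∘ v₁.restrict ∧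
      v.restrict ∘ Set.inclusion i₂ = Set.inclusion j₂ ∘ v₂.restrict ∧
      -- the lower left and lower right squares commute
      o₁.restrict ∘ l₁.restrict = l.restrict ∘ Set.inclusion j₁ ∧
      o₂.restrict ∘ l₂.restrict = l.restrict ∘ Set.inclusion j₂ := by
  subst hF hG
  have hF := trop_ne_zero hf
  have hG := trop_ne_zero hg
  have hV := variety_mul f g
  have hT := tropVariety_mul hF hG
  have hT' := tropVariety_trop_mul hf hg
  refine ⟨hV, hT, hT'.trans hT.symm, mapsTo_odot_dome hF hG, ?_, ?_, ?_, ?_, ?_, ?_, ?_, ?_, ?_, ?_,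
    ?_, ?_, ?_, ?_⟩
  · rw [mul_comm]
    exact mapsTo_odot_dome hG hF
  · rw [hV]
    exact Set.subset_union_left
  · rw [hV]
    exact Set.subset_union_right
  · exact fun _ => torusVal_mem_tropVariety hf
  -- The set `T(F ⊙ G)` equals `T(trop (f * g))`, so the result on zeros applies to `f * g`.
  · rw [hT, ← hT']
    exact fun _ => torusVal_mem_tropVariety (mul_ne_zero hf hg)
  · exact fun _ => torusVal_mem_tropVariety hg
  · rw [hT]
    exact Set.subset_union_left
  · rw [hT]
    exact Set.subset_union_right
  · exact mapsTo_lift hF _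
  · exact mapsTo_lift (mul_ne_zero_of_tropValue hF hG) _
  · exact mapsTo_lift hG _
  · exact mapsTo_odot_frontier hF hG
  · rw [mul_comm]
    exact mapsTo_odot_frontier hG hF
  · refine ⟨rfl, rfl, ?_, ?_⟩
    · funext w
      exact Subtype.ext (odot_lift hF hG w)
    · funext w
      refine Subtype.ext ((odot_lift hG hF w).trans ?_)
      rw [mul_comm]
      rfl
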